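/- Let $\mathbb{K}$ be $\mathbb{R}$ or $\mathbb{C}$, let $\mathbb{N}=\{1,2,3,\dots\}$, and let $p\in\{0\}\cup[1,\infty)$. Let $A=(a_{j,k})_{j\in\mathbb{Z},k\in\mathbb{N}}$ be a Köthe matrix on $\mathbb{Z}$ with nonzero entries, that is, a family of real numbers with $0<a_{j,k}\le a_{j,k+1}$ for all $j\in\mathbb{Z}$ and $k\in\mathbb{N}$. The Köthe sequence space $X=\lambda_p(A,\mathbb{Z})$ is the Fréchet space of all $x=(x_j)_{j\in\mathbb{Z}}\in\mathbb{K}^{\mathbb{Z}}$ such that, for all $k\in\mathbb{N}$, $\sum_{j\in\mathbb{Z}}|a_{j,k}x_j|^p<\infty$ if $p\ge 1$, respectively $\lim_{|j|\to\infty}a_{j,k}x_j=0$ if $p=0$. Its topology is defined by the seminorms $\|x\|_k=\big(\sum_{j\in\mathbb{Z}}|a_{j,k}x_j|^p\big)^{1/p}$ if $p\ge1$, respectively $\|x\|_k=\sup_{j\in\mathbb{Z}}|a_{j,k}x_j|$ if $p=0$ $(k\in\mathbb{N})$. Let $d$ be any translation-invariant metric on $X$ that induces this topology, for example $d(x,y)=\sum_{k}\min\{2^{-k},\|x-y\|_k\}$.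 A continuous map $f:X\to X$ is called Li-Yorke chaotic if there is an uncountable set $S\subset X$ such that $$\liminf_{n\to\infty}d(f^n(x),f^n(y))=0\quad\text{and}\quad\limsup_{n\to\infty}d(f^n(x),f^n(y))>0$$ for all $x,y\in S$ with $x\ne y$. **Theorem.** Let $w=(w_n)_{n\in\mathbb{Z}}$ be a sequence of nonzero scalars in $\mathbb{K}$ such that the bilateral weighted backward shift $B_w((x_n)_{n\in\mathbb{Z}})=(w_nx_{n+1})_{n\in\mathbb{Z}}$ maps $X$ into itself. Then $B_w$ is Li-Yorke chaotic if and only if the following two conditions hold: (a) There is a strictly increasing sequence $(n_i)_{i\in\mathbb{N}}$ of positive integers such that $$\lim_{i\to\infty}a_{-n_i,k}\,w_{-n_i}\cdots w_{-1}=0\quad\text{for all }k\in\mathbb{N}.$$ (b) There exists $k\in\mathbb{N}$ such that $$\sup\left\{\frac{a_{i,k}\,|w_i\cdots w_j|}{a_{j+1,\ell}} : i,j\in\mathbb{Z},\ i\le j\right\}=\infty\quad\text{for all }\ell\in\mathbb{N}.$$ -/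

import Mathlib

open Filter Topology

/-- A continuous self-map `f` of a metric space is *Li-Yorke chaotic* if there is an uncountable set
`S` such that any two distinct points `x, y` of `S` satisfy
`liminf d(fⁿ x, fⁿ y) = 0` and `limsup d(fⁿ x, fⁿ y) > 0`.
The lower and upper limits are taken in `[0, ∞]`, so that unbounded orbits cause no trouble. -/
def LiYorkeChaotic {M : Type*} [MetricSpace M] (f : M → M) : Prop :=
  Continuous f ∧ ∃ S : Set M, ¬ S.Countable ∧ ∀ x ∈ S, ∀ y ∈ S, x ≠ y →
    liminf (fun n : ℕ => edist (f^[n] x) (f^[n] y)) atTop = 0 ∧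
    0 < limsup (fun n : ℕ => edist (f^[n] x) (f^[n] y)) atTop

/-- Köthe matrices on `ℤ`. The second index, which is only used through its order, runs through
`ℕ = {0, 1, 2, …}`. -/
structure IsKotheMatrix (a : ℤ → ℕ → ℝ) : Prop where
  exists_pos : ∀ j, ∃ k, 0 < a j k
  nonneg : ∀ j k, 0 ≤ a j k
  le_succ : ∀ j k, a j k ≤ a j (k + 1)

section Kothe

variable (𝕜 : Type*) [RCLike 𝕜] (p : ℝ) (a : ℤ → ℕ → ℝ)

/-- The condition imposed on `x` by the `k`-th column of the matrix: `a_{j,k} x_j → 0` as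
`|j| → ∞` (along the cofinite filter of `ℤ`) if `p = 0`, and
`∑_j |a_{j,k} x_j| ^ p < ∞` otherwise. -/
def KotheCond (k : ℕ) (x : ℤ → 𝕜) : Prop :=
  if p = 0 then Tendsto (fun j => (a j k : 𝕜) * x j) cofinite (𝓝 0)
  else Summable (fun j => ‖(a j k : 𝕜) * x j‖ ^ p)

/-- The `k`-th seminorm: `sup_j |a_{j,k} x_j|` if `p = 0`, and
`(∑_j |a_{j,k} x_j| ^ p) ^ (1 / p)` otherwise. -/
noncomputable def kotheNorm (k : ℕ) (x : ℤ → 𝕜) : ℝ :=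
  if p = 0 then ⨆ j, ‖(a j k : 𝕜) * x j‖
  else (∑' j, ‖(a j k : 𝕜) * x j‖ ^ p) ^ (1 / p)

variable {𝕜 p a}

theorem KotheCond.bddAbove {k : ℕ} {x : ℤ → 𝕜} (hp : p = 0) (h : KotheCond 𝕜 p a k x) :
    BddAbove (Set.range fun j => ‖(a j k : 𝕜) * x j‖) := by
  simp only [KotheCond, if_pos hp] at h
  exact h.norm.bddAbove_range_of_cofinite

theorem KotheCond.add_and_norm_le [hp : Fact (p = 0 ∨ 1 ≤ p)] {k : ℕ} {x y : ℤ → 𝕜}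
    (hx : KotheCond 𝕜 p a k x) (hy : KotheCond 𝕜 p a k y) :
    KotheCond 𝕜 p a k (x + y) ∧
      kotheNorm 𝕜 p a k (x + y) ≤ kotheNorm 𝕜 p a k x + kotheNorm 𝕜 p a k y := by
  rcases hp.out with h0 | h1
  · refine ⟨?_, ?_⟩
    · simp only [KotheCond, if_pos h0] at hx hy ⊢
      simpa [mul_add] using hx.add hy
    · have bx := hx.bddAbove h0
      have bey := hy.bddAbove h0
      simp only [kotheNorm, if_pos h0]
      refine ciSup_le fun j => ?_
      calc ‖(a j k : 𝕜) * (x + y) j‖ ≤ ‖(a j k : 𝕜) * x j‖ + ‖(a j k : 𝕜) * y j‖ := by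
            rw [Pi.add_apply, mul_add]; exact norm_add_le _ _
        _ ≤ _ := add_le_add (le_ciSup bx j) (le_ciSup bey j)
  · have h0 : p ≠ 0 := by linarith
    have hp0 : 0 ≤ p := by linarith
    simp only [KotheCond, kotheNorm, if_neg h0] at hx hy ⊢
    have key := Real.Lp_add_le_tsum_of_nonneg h1
      (fun j => norm_nonneg ((a j k : 𝕜) * x j)) (fun j => norm_nonneg ((a j k : 𝕜) * y j)) hx hy
    have hle : ∀ j, ‖(a j k : 𝕜) * (x + y) j‖ ^ p
        ≤ (‖(a j k : 𝕜) * x j‖ + ‖(a j k : 𝕜) * y j‖) ^ p := fun j => by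
      rw [Pi.add_apply, mul_add]
      exact Real.rpow_le_rpow (norm_nonneg _) (norm_add_le _ _) hp0
    have hs : Summable fun j => ‖(a j k : 𝕜) * (x + y) j‖ ^ p :=
      key.1.of_nonneg_of_le (fun j => by positivity) hle
    refine ⟨hs, le_trans ?_ key.2⟩
    exact Real.rpow_le_rpow (tsum_nonneg fun j => by positivity)
      (hs.tsum_le_tsum hle key.1) (by positivity)

theorem KotheCond.smul {k : ℕ} {x : ℤ → 𝕜} (c : 𝕜) (hx : KotheCond 𝕜 p a k x) :
    KotheCond 𝕜 p a k (c • x) := by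
  unfold KotheCond at hx ⊢
  split_ifs at hx ⊢ with h0
  · simpa [mul_left_comm] using hx.const_mul c
  · refine (hx.mul_left (‖c‖ ^ p)).congr fun j => ?_
    rw [← Real.mul_rpow (norm_nonneg _) (norm_nonneg _), ← norm_mul, Pi.smul_apply, smul_eq_mul,
      mul_left_comm]

theorem kotheNorm_smul (k : ℕ) (c : 𝕜) (x : ℤ → 𝕜) :
    kotheNorm 𝕜 p a k (c • x) = ‖c‖ * kotheNorm 𝕜 p a k x := by
  have e : ∀ j, ‖(a j k : 𝕜) * (c • x) j‖ = ‖c‖ * ‖(a j k : 𝕜) * x j‖ := fun j => by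
    rw [← norm_mul, Pi.smul_apply, smul_eq_mul, mul_left_comm]
  unfold kotheNorm
  split_ifs with h0
  · simp only [e, Real.mul_iSup_of_nonneg (norm_nonneg c)]
  · simp only [e, Real.mul_rpow (norm_nonneg _) (norm_nonneg _), tsum_mul_left]
    rw [Real.mul_rpow (by positivity) (tsum_nonneg fun j => by positivity), one_div,
      Real.rpow_rpow_inv (norm_nonneg _) h0]

variable (𝕜 p a)

/-- The sequences in `𝕜^ℤ` that belong to `λ_p(A, ℤ)`. -/
def kotheSubmodule [hp : Fact (p = 0 ∨ 1 ≤ p)] : Submodule 𝕜 (ℤ → 𝕜) where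
  carrier := {x | ∀ k, KotheCond 𝕜 p a k x}
  add_mem' hx hy k := ((hx k).add_and_norm_le (hy k)).1
  zero_mem' k := by
    unfold KotheCond
    split_ifs with h0
    · simp
    · simp [Real.zero_rpow h0]
  smul_mem' c x hx k := (hx k).smul c

/-- The Köthe sequence space `λ_p(A, ℤ)`. As a type of its own it does not inherit the topology of
coordinatewise convergence. -/
def KotheSpace [Fact (p = 0 ∨ 1 ≤ p)] : Type _ := kotheSubmodule 𝕜 p a

variable [Fact (p = 0 ∨ 1 ≤ p)]

noncomputable instance : AddCommGroup (KotheSpace 𝕜 p a) :=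
  inferInstanceAs (AddCommGroup (kotheSubmodule 𝕜 p a))

noncomputable instance : Module 𝕜 (KotheSpace 𝕜 p a) :=
  inferInstanceAs (Module 𝕜 (kotheSubmodule 𝕜 p a))

/-- The sequence of seminorms that defines the topology of `λ_p(A, ℤ)`. -/
noncomputable def kotheSeminorm : SeminormFamily 𝕜 (KotheSpace 𝕜 p a) ℕ := fun k =>
  Seminorm.of (fun x => kotheNorm 𝕜 p a k x.1)
    (fun x y => ((x.2 k).add_and_norm_le (y.2 k)).2)
    (fun c x => kotheNorm_smul k c x.1)

/-- `d` is one of the metrics of the Fréchet space `λ_p(A, ℤ)`: it is invariant under translations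
and induces the topology given by the seminorms. -/
structure IsKotheMetric (d : MetricSpace (KotheSpace 𝕜 p a)) : Prop where
  dist_add_right : ∀ x y z : KotheSpace 𝕜 p a, dist (x + z) (y + z) = dist x y
  withSeminorms : WithSeminorms (kotheSeminorm 𝕜 p a)

end Kothe

theorem kotheNorm_ne_zero {𝕜 : Type*} [RCLike 𝕜] {p : ℝ} {a : ℤ → ℕ → ℝ} [hp : Fact (p = 0 ∨ 1 ≤ p)]
    {k : ℕ} {x : ℤ → 𝕜} (hx : KotheCond 𝕜 p a k x) {j : ℤ} (hj : 0 < a j k) (hxj : x j ≠ 0) :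
    kotheNorm 𝕜 p a k x ≠ 0 := by
  have hpos : 0 < ‖(a j k : 𝕜) * x j‖ :=
    norm_pos_iff.2 (mul_ne_zero (by exact_mod_cast hj.ne') hxj)
  rcases hp.out with h0 | h1
  · have hb := hx.bddAbove h0
    simp only [kotheNorm, if_pos h0]
    exact (hpos.trans_le (le_ciSup hb j)).ne'
  · have h0 : p ≠ 0 := by linarith
    simp only [KotheCond, kotheNorm, if_neg h0] at hx ⊢
    exact (Real.rpow_pos_of_pos (hx.tsum_pos (fun i => by positivity) j
      (Real.rpow_pos_of_pos hpos p)) _).ne'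

/-- Metrics as in `IsKotheMetric` exist: the usual one is
`d(x, y) = ∑_k min(2 ^ (-k), ‖x - y‖_k)`. -/
theorem exists_isKotheMetric (𝕜 : Type*) [RCLike 𝕜] (p : ℝ) (a : ℤ → ℕ → ℝ)
    [Fact (p = 0 ∨ 1 ≤ p)] (hA : IsKotheMatrix a) :
    ∃ d : MetricSpace (KotheSpace 𝕜 p a), IsKotheMetric 𝕜 p a d := by
  let q := kotheSeminorm 𝕜 p a
  let P : ∀ k : ℕ, PseudoMetricSpace (KotheSpace 𝕜 p a) := fun k =>
    (q k).toSeminormedAddCommGroup.toPseudoMetricSpace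
  let D : PseudoMetricSpace (KotheSpace 𝕜 p a) :=
    PseudoMetricSpace.induced (fun x (_ : ℕ) => x)
      (@PiCountable.pseudoMetricSpace ℕ _ (fun _ => KotheSpace 𝕜 p a) P)
  have hdist : ∀ x y : KotheSpace 𝕜 p a,
      dist x y = ∑' k : ℕ, min (2⁻¹ ^ Encodable.encode k) (q k (x - y)) := fun x y => by
    refine (@PiCountable.dist_eq_tsum ℕ _ (fun _ => KotheSpace 𝕜 p a) P _ _).trans ?_
    refine tsum_congr fun k => ?_
    congr 1
    exact @dist_eq_norm _ (q k).toSeminormedAddCommGroup x y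
  have hle : ∀ (x y : KotheSpace 𝕜 p a) (k : ℕ),
      min (2⁻¹ ^ Encodable.encode k) (q k (x - y)) ≤ dist x y := fun x y k => by
    refine le_trans (le_of_eq ?_)
      (@PiCountable.min_dist_le_dist_pi ℕ _ (fun _ => KotheSpace 𝕜 p a) P _ _ k)
    congr 1
    exact (@dist_eq_norm _ (q k).toSeminormedAddCommGroup x y).symm
  have hU : D.toUniformSpace = ⨅ k, (q k).toSeminormedAddCommGroup.toUniformSpace := by
    have e : D.toUniformSpace = UniformSpace.comap (fun x (_ : ℕ) => x)
        (@Pi.uniformSpace ℕ (fun _ => KotheSpace 𝕜 p a) fun k => (P k).toUniformSpace) := rfl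
    rw [e, Pi.uniformSpace_eq, UniformSpace.comap_iInf]
    refine iInf_congr fun k => ?_
    rw [← UniformSpace.comap_comap]
    exact congr_fun uniformSpace_comap_id _
  refine ⟨{ D with eq_of_dist_eq_zero := ?_ }, ?_, ?_⟩
  · intro x y h
    by_contra hne
    have : ∃ j, (x - y).1 j ≠ 0 := by
      by_contra! hall
      exact hne (sub_eq_zero.1 (Subtype.ext (funext hall)))
    obtain ⟨j, hj⟩ := this
    obtain ⟨k, hk⟩ := hA.exists_pos j
    have h1 : q k (x - y) ≠ 0 := kotheNorm_ne_zero ((x - y).2 k) hk hj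
    have h2 : 0 < q k (x - y) := lt_of_le_of_ne (apply_nonneg _ _) h1.symm
    have h3 := hle x y k
    have h4 : (0 : ℝ) < min (2⁻¹ ^ Encodable.encode k) (q k (x - y)) := lt_min (by positivity) h2
    rw [h] at h3
    linarith
  · intro x y z
    change @dist _ D.toDist (x + z) (y + z) = @dist _ D.toDist x y
    rw [hdist, hdist, add_sub_add_right_eq_sub]
  · have : @IsUniformAddGroup _ D.toUniformSpace _ := by
      rw [hU]; exact isUniformAddGroup_iInf fun k => inferInstance
    exact q.withSeminorms_iff_uniformSpace_eq_iInf.2 hU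

/-- The weighted backward shift `(x_n) ↦ (w_n x_{n+1})` on `𝕜^ℤ`. -/
def bilateralShift {𝕜 : Type*} [RCLike 𝕜] (w : ℤ → 𝕜) : (ℤ → 𝕜) →ₗ[𝕜] (ℤ → 𝕜) where
  toFun x n := w n * x (n + 1)
  map_add' x y := by ext n; simp [mul_add]
  map_smul' c x := by ext n; simp [mul_left_comm]

/-- The weighted backward shift `B_w` on `λ_p(A, ℤ)`, provided it maps this space into itself. -/
def kotheShift {𝕜 : Type*} [RCLike 𝕜] (p : ℝ) [Fact (p = 0 ∨ 1 ≤ p)] (a : ℤ → ℕ → ℝ) (w : ℤ → 𝕜)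
    (hB : ∀ x ∈ kotheSubmodule 𝕜 p a, bilateralShift w x ∈ kotheSubmodule 𝕜 p a) :
    KotheSpace 𝕜 p a → KotheSpace 𝕜 p a :=
  fun x => ⟨bilateralShift w x.1, hB x.1 x.2⟩

/-! ### Estimates for the Köthe norms -/

section KotheNorm

variable {𝕜 : Type*} [RCLike 𝕜] {p : ℝ} {a : ℤ → ℕ → ℝ}

/-! For a continuous linear map, Li-Yorke chaos amounts to the existence of one semi-irregular
vector: its orbit has a null subsequence but is not null (`IsKotheMetric.liYorkeChaotic_iff`). For
B_w everything is read off the numbers `orbitNorm a w k n j` = ‖B_wⁿ e_j‖_k, since ‖B_wⁿ x‖_k is the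
norm of x with these numbers as weights. Condition (a) says that the orbit of e_0, hence of every
e_j, has a null subsequence; (b) says that the iterates are not equicontinuous.

Necessity: if z is semi-irregular and z_m ≠ 0, the orbit of z dominates that of z_m e_m, which gives
(a). Were the iterates equicontinuous, an orbit that comes close to 0 would stay close, so (b)
holds.

Sufficiency: if the orbit of some e_j is not null, (a) makes e_j semi-irregular. Otherwise a gliding
hump (`exists_glidingHump`) yields z = ∑ c_t e_{J t}, where c_t e_{J t} has norm 1 at time n_t,
while at the times m_s all terms together are small.

The cases p = 0 and p ≥ 1 are handled together, because each norm lies between the largest weighted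
coordinate and the weighted ℓ¹ sum. Continuity of B_w is derived from the invariance of the space
(`exists_weight_mul_norm_le`). -/

theorem norm_kothe_weight_mul {j : ℤ} {k : ℕ} (h : 0 ≤ a j k) (x : 𝕜) :
    ‖(a j k : 𝕜) * x‖ = a j k * ‖x‖ := by
  rw [norm_mul, RCLike.norm_ofReal, abs_of_nonneg h]

theorem kotheNorm_nonneg (k : ℕ) (x : ℤ → 𝕜) : 0 ≤ kotheNorm 𝕜 p a k x := by
  unfold kotheNorm
  split_ifs
  · exact Real.iSup_nonneg fun j => norm_nonneg _
  · exact Real.rpow_nonneg (tsum_nonneg fun j => by positivity) _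

theorem KotheCond.weight_mul_norm_le [hp : Fact (p = 0 ∨ 1 ≤ p)] {k : ℕ} {x : ℤ → 𝕜}
    (h0 : ∀ j, 0 ≤ a j k) (hx : KotheCond 𝕜 p a k x) (j : ℤ) :
    a j k * ‖x j‖ ≤ kotheNorm 𝕜 p a k x := by
  rw [← norm_kothe_weight_mul (h0 j)]
  rcases hp.out with hp0 | hp1
  · simp only [kotheNorm, if_pos hp0]
    exact le_ciSup (hx.bddAbove hp0) j
  · have hne : p ≠ 0 := by linarith
    simp only [kotheNorm, KotheCond, if_neg hne] at hx ⊢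
    rw [one_div, Real.le_rpow_inv_iff_of_pos (norm_nonneg _)
      (tsum_nonneg fun j => by positivity) (by linarith)]
    exact hx.le_tsum j fun i _ => by positivity

/-- If `y` is dominated by a translate of `x`, in the weighted sense, so is its norm. -/
theorem kotheNorm_le_of_shift [hp : Fact (p = 0 ∨ 1 ≤ p)] {k l : ℕ} {x y : ℤ → 𝕜}
    (h0 : ∀ j k, 0 ≤ a j k) (hx : KotheCond 𝕜 p a l x) {C : ℝ} (hC : 0 ≤ C) (n : ℤ)
    (hle : ∀ i, a i k * ‖y i‖ ≤ C * (a (i + n) l * ‖x (i + n)‖)) :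
    kotheNorm 𝕜 p a k y ≤ C * kotheNorm 𝕜 p a l x := by
  have hle' : ∀ i, ‖(a i k : 𝕜) * y i‖ ≤ C * ‖(a (i + n) l : 𝕜) * x (i + n)‖ := fun i => by
    simpa only [norm_kothe_weight_mul (h0 _ _)] using hle i
  rcases hp.out with hp0 | hp1
  · have hb := hx.bddAbove hp0
    simp only [kotheNorm, if_pos hp0]
    exact ciSup_le fun i => (hle' i).trans
      (mul_le_mul_of_nonneg_left (le_ciSup hb (i + n)) hC)
  · have hne : p ≠ 0 := by linarith
    simp only [kotheNorm, KotheCond, if_neg hne] at hx ⊢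
    have hs : Summable fun i => C ^ p * ‖(a (i + n) l : 𝕜) * x (i + n)‖ ^ p :=
      (((Equiv.addRight n).summable_iff
        (f := fun i => ‖(a i l : 𝕜) * x i‖ ^ p)).2 hx).mul_left (C ^ p)
    have hle2 : ∀ i, ‖(a i k : 𝕜) * y i‖ ^ p ≤ C ^ p * ‖(a (i + n) l : 𝕜) * x (i + n)‖ ^ p :=
      fun i => by
        rw [← Real.mul_rpow hC (norm_nonneg _)]
        exact Real.rpow_le_rpow (norm_nonneg _) (hle' i) (by linarith)
    have hs' : Summable fun i => ‖(a i k : 𝕜) * y i‖ ^ p :=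
      hs.of_nonneg_of_le (fun i => by positivity) hle2
    have key : ∑' i, ‖(a i k : 𝕜) * y i‖ ^ p ≤ C ^ p * ∑' i, ‖(a i l : 𝕜) * x i‖ ^ p := by
      refine (hs'.tsum_le_tsum hle2 hs).trans_eq ?_
      rw [tsum_mul_left]
      congr 1
      exact (Equiv.addRight n).tsum_eq (fun i => ‖(a i l : 𝕜) * x i‖ ^ p)
    calc (∑' i, ‖(a i k : 𝕜) * y i‖ ^ p) ^ (1 / p)
        ≤ (C ^ p * ∑' i, ‖(a i l : 𝕜) * x i‖ ^ p) ^ (1 / p) :=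
          Real.rpow_le_rpow (tsum_nonneg fun j => by positivity) key (by positivity)
      _ = _ := by
          rw [Real.mul_rpow (by positivity) (tsum_nonneg fun j => by positivity), one_div,
            Real.rpow_rpow_inv hC hne]

/-- The weighted `ℓ¹` norm dominates the Köthe norms. -/
theorem kotheCond_and_norm_le_tsum [hp : Fact (p = 0 ∨ 1 ≤ p)] {k : ℕ} {x : ℤ → 𝕜}
    (h0 : ∀ j, 0 ≤ a j k) (hx : Summable fun j => a j k * ‖x j‖) :
    KotheCond 𝕜 p a k x ∧ kotheNorm 𝕜 p a k x ≤ ∑' j, a j k * ‖x j‖ := by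
  have e : ∀ j, ‖(a j k : 𝕜) * x j‖ = a j k * ‖x j‖ := fun j => norm_kothe_weight_mul (h0 j) _
  have hn : ∀ j, 0 ≤ a j k * ‖x j‖ := fun j => mul_nonneg (h0 j) (norm_nonneg _)
  have hle : ∀ j, a j k * ‖x j‖ ≤ ∑' j, a j k * ‖x j‖ := fun j => hx.le_tsum j fun i _ => hn i
  unfold KotheCond kotheNorm
  rcases hp.out with hp0 | hp1
  · simp only [if_pos hp0]
    refine ⟨?_, ciSup_le fun j => (e j).trans_le (hle j)⟩
    rw [tendsto_zero_iff_norm_tendsto_zero]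
    simpa only [e] using hx.tendsto_cofinite_zero
  · have hne : p ≠ 0 := by linarith
    simp only [if_neg hne, e]
    set S := ∑' j, a j k * ‖x j‖ with hS
    have hS0 : 0 ≤ S := tsum_nonneg hn
    -- Each term is at most the total S, so p - 1 of its factors can be replaced by S; summing then
    -- gives S ^ p.
    have key : ∀ j, (a j k * ‖x j‖) ^ p ≤ S ^ (p - 1) * (a j k * ‖x j‖) := fun j => by
      rcases (hn j).eq_or_lt with h | h
      · rw [← h, Real.zero_rpow hne, mul_zero]
      · calc (a j k * ‖x j‖) ^ p = (a j k * ‖x j‖) ^ (p - 1) * (a j k * ‖x j‖) := by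
              rw [Real.rpow_sub_one h.ne', div_mul_cancel₀ _ h.ne']
          _ ≤ _ := mul_le_mul_of_nonneg_right
              (Real.rpow_le_rpow (hn j) (hle j) (by linarith)) (hn j)
    have hs : Summable fun j => (a j k * ‖x j‖) ^ p :=
      (hx.mul_left _).of_nonneg_of_le (fun j => Real.rpow_nonneg (hn j) _) key
    refine ⟨hs, ?_⟩
    rw [one_div, Real.rpow_inv_le_iff_of_pos (tsum_nonneg fun j => Real.rpow_nonneg (hn j) _) hS0
      (by linarith)]
    refine (hs.tsum_le_tsum key (hx.mul_left _)).trans ?_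
    rw [tsum_mul_left, ← hS]
    rcases hS0.eq_or_lt with h | h
    · rw [← h, mul_zero, Real.zero_rpow hne]
    · rw [Real.rpow_sub_one h.ne', div_mul_cancel₀ _ h.ne']

end KotheNorm

/-! ### Norms of the iterates on basis vectors -/

section Weights

variable {𝕜 : Type*} [RCLike 𝕜] (a : ℤ → ℕ → ℝ) (w : ℤ → 𝕜)

/-- The modulus `|w_{j-n} ⋯ w_{j-1}|` of the coefficient of `B_wⁿ e_j`. -/
noncomputable def weightProd (j : ℤ) (n : ℕ) : ℝ := ∏ q ∈ Finset.range n, ‖w (j - 1 - q)‖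

/-- The `k`-th Köthe norm of `B_wⁿ e_j`. -/
noncomputable def orbitNorm (k n : ℕ) (j : ℤ) : ℝ := a (j - n) k * weightProd w j n

variable {a w}

theorem weightProd_pos (hw : ∀ n, w n ≠ 0) (j : ℤ) (n : ℕ) : 0 < weightProd w j n :=
  Finset.prod_pos fun _ _ => norm_pos_iff.2 (hw _)

theorem weightProd_succ (j : ℤ) (n : ℕ) :
    weightProd w j (n + 1) = weightProd w j n * ‖w (j - 1 - n)‖ :=
  Finset.prod_range_succ _ _

theorem weightProd_succ' (j : ℤ) (n : ℕ) :
    weightProd w j (n + 1) = weightProd w (j - 1) n * ‖w (j - 1)‖ := by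
  unfold weightProd
  rw [Finset.prod_range_succ']
  congr 1
  · refine Finset.prod_congr rfl fun q _ => ?_
    congr 2; push_cast; ring
  · simp

theorem norm_prod_Icc_eq_weightProd (j : ℤ) (n : ℕ) :
    ‖∏ m ∈ Finset.Icc (j - n) (j - 1), w m‖ = weightProd w j n := by
  rw [norm_prod]
  induction n with
  | zero => simp [weightProd]
  | succ n ih =>
    rw [weightProd_succ, ← ih]
    have : Finset.Icc (j - ((n + 1 : ℕ) : ℤ)) (j - 1)
        = insert (j - 1 - n) (Finset.Icc (j - n) (j - 1)) := by
      ext m; simp only [Finset.mem_Icc, Finset.mem_insert]; push_cast; omega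
    rw [this, Finset.prod_insert (by simp), mul_comm]

theorem orbitNorm_pos (ha : ∀ j k, 0 < a j k) (hw : ∀ n, w n ≠ 0) (k n : ℕ) (j : ℤ) :
    0 < orbitNorm a w k n j :=
  mul_pos (ha _ _) (weightProd_pos hw j n)

theorem orbitNorm_zero (k : ℕ) (j : ℤ) : orbitNorm a w k 0 j = a j k := by
  simp [orbitNorm, weightProd]

theorem orbitNorm_succ_add_one (k n : ℕ) (j : ℤ) :
    orbitNorm a w k (n + 1) (j + 1) = orbitNorm a w k n j * ‖w j‖ := by
  unfold orbitNorm
  rw [weightProd_succ', add_sub_cancel_right, mul_assoc]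
  congr 2; push_cast; ring

/-- The orbits of `e_j` and `e_{j+1}` have the same recurrence to zero. -/
theorem exists_orbitNorm_tendsto_add_one_iff (hw : ∀ n, w n ≠ 0) (j : ℤ) :
    (∃ φ : ℕ → ℕ, StrictMono φ ∧ ∀ k, Tendsto (fun i => orbitNorm a w k (φ i) (j + 1)) atTop (𝓝 0))
      ↔ ∃ φ : ℕ → ℕ, StrictMono φ ∧
        ∀ k, Tendsto (fun i => orbitNorm a w k (φ i) j) atTop (𝓝 0) := by
  constructor
  · rintro ⟨φ, hφ, h⟩
    -- Times are lowered by one, so the possible initial value φ 0 = 0 is dropped.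
    have hpos : ∀ i, 0 < φ (i + 1) := fun i => (Nat.zero_le _).trans_lt (hφ (Nat.lt_succ_self i))
    refine ⟨fun i => φ (i + 1) - 1, fun i i' hi => ?_, fun k => ?_⟩
    · have := hφ (Nat.succ_lt_succ hi)
      have := hpos i
      simp only [Nat.succ_eq_add_one] at *
      omega
    · have h1 := ((h k).comp (tendsto_add_atTop_nat 1)).mul_const (‖w j‖⁻¹)
      rw [zero_mul] at h1
      refine h1.congr fun i => ?_
      have e : φ (i + 1) = (φ (i + 1) - 1) + 1 := (Nat.sub_add_cancel (hpos i)).symm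
      have := norm_ne_zero_iff.2 (hw j)
      simp only [Function.comp_apply]
      rw [e, orbitNorm_succ_add_one, Nat.add_sub_cancel, mul_inv_cancel_right₀ this]
  · rintro ⟨φ, hφ, h⟩
    refine ⟨fun i => φ i + 1, fun i i' hi => Nat.succ_lt_succ (hφ hi), fun k => ?_⟩
    have h1 := (h k).mul_const ‖w j‖
    rw [zero_mul] at h1
    exact h1.congr fun i => (orbitNorm_succ_add_one k (φ i) j).symm

/-- Passing between neighbours in both directions reaches every index from 0, so (a) does not depend
on the chosen basis vector. -/
theorem exists_orbitNorm_tendsto_iff (hw : ∀ n, w n ≠ 0) (j : ℤ) :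
    (∃ φ : ℕ → ℕ, StrictMono φ ∧ ∀ k, Tendsto (fun i => orbitNorm a w k (φ i) j) atTop (𝓝 0))
      ↔ ∃ φ : ℕ → ℕ, StrictMono φ ∧
        ∀ k, Tendsto (fun i => orbitNorm a w k (φ i) 0) atTop (𝓝 0) := by
  induction j with
  | zero => rfl
  | succ i ih => rw [exists_orbitNorm_tendsto_add_one_iff hw, ih]
  | pred i ih =>
    rw [← ih, ← exists_orbitNorm_tendsto_add_one_iff hw (-(i : ℤ) - 1), sub_add_cancel]

/-- Boundedness of one step carries over to finitely many steps. -/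
theorem exists_orbitNorm_le (ha : ∀ j k, 0 < a j k)
    (h1 : ∀ k, ∃ l C, ∀ i, a i k * ‖w i‖ ≤ C * a (i + 1) l) (k n : ℕ) :
    ∃ l C, ∀ j, orbitNorm a w k n j ≤ C * a j l := by
  induction n with
  | zero => exact ⟨k, 1, fun j => by rw [orbitNorm_zero, one_mul]⟩
  | succ n ih =>
    obtain ⟨l, C, h⟩ := ih
    obtain ⟨l', C', h'⟩ := h1 l
    have hC : 0 ≤ |C| := abs_nonneg C
    refine ⟨l', |C| * C', fun j => ?_⟩
    have e : orbitNorm a w k (n + 1) j = orbitNorm a w k n (j - 1) * ‖w (j - 1)‖ := by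
      rw [← orbitNorm_succ_add_one, sub_add_cancel]
    rw [e]
    calc orbitNorm a w k n (j - 1) * ‖w (j - 1)‖ ≤ (|C| * a (j - 1) l) * ‖w (j - 1)‖ := by
          refine mul_le_mul_of_nonneg_right ((h _).trans ?_) (norm_nonneg _)
          exact mul_le_mul_of_nonneg_right (le_abs_self C) (ha _ _).le
      _ ≤ |C| * (C' * a j l') := by
          rw [mul_assoc]
          refine mul_le_mul_of_nonneg_left ?_ hC
          simpa using h' (j - 1)
      _ = _ := by ring

end Weights

/-! ### Sparse vectors, automatic continuity and the gliding hump -/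

section GlidingHump

variable {𝕜 : Type*} [RCLike 𝕜] {a : ℤ → ℕ → ℝ} {w : ℤ → 𝕜}

theorem hasSum_mul_norm_extend_iff {J : ℕ → ℤ} (hJ : Function.Injective J) {c : ℕ → ℝ}
    (hc : ∀ t, 0 ≤ c t) (b : ℤ → ℝ) (S : ℝ) :
    HasSum (fun j => b j * ‖Function.extend J (fun t => (c t : 𝕜)) 0 j‖) S ↔
      HasSum (fun t => b (J t) * c t) S := by
  rw [← hJ.hasSum_iff]
  · refine iff_of_eq (congrArg (HasSum · S) (funext fun t => ?_))
    simp only [Function.comp_apply, hJ.extend_apply, RCLike.norm_ofReal, abs_of_nonneg (hc t)]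
  · intro j hj
    rw [Function.extend_apply' _ _ _ fun ⟨t, ht⟩ => hj ⟨t, ht⟩, Pi.zero_apply, norm_zero, mul_zero]

/-- A sequence supported on `J` whose `t`-th entry has `t`-th weight at most `2⁻ᵗ` lies in the
Köthe space. -/
theorem extend_mem_kotheSubmodule {p : ℝ} [Fact (p = 0 ∨ 1 ≤ p)] (h0 : ∀ j k, 0 ≤ a j k)
    (hmono : ∀ j, Monotone (a j)) {J : ℕ → ℤ} (hJ : Function.Injective J) {c : ℕ → ℝ}
    (hc : ∀ t, 0 ≤ c t) (hle : ∀ t, a (J t) t * c t ≤ (1 / 2) ^ t) :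
    Function.extend J (fun t => (c t : 𝕜)) 0 ∈ kotheSubmodule 𝕜 p a := by
  intro l
  refine (kotheCond_and_norm_le_tsum (fun j => h0 j l) ?_).1
  have hs : Summable fun t => a (J t) l * c t := by
    refine Summable.of_norm_bounded_eventually_nat summable_geometric_two ?_
    filter_upwards [eventually_ge_atTop l] with t ht
    rw [Real.norm_of_nonneg (mul_nonneg (h0 _ _) (hc t))]
    exact (mul_le_mul_of_nonneg_right (hmono _ ht) (hc t)).trans (hle t)
  exact ((hasSum_mul_norm_extend_iff hJ hc (fun j => a j l) _).2 hs.hasSum).summable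

/-- A weighted shift that maps the Köthe space into itself is bounded for the seminorms. -/
theorem exists_weight_mul_norm_le {p : ℝ} [hp : Fact (p = 0 ∨ 1 ≤ p)] (ha : ∀ j k, 0 < a j k)
    (hmono : ∀ j, Monotone (a j)) (hw : ∀ n, w n ≠ 0)
    (hB : ∀ x ∈ kotheSubmodule 𝕜 p a, bilateralShift w x ∈ kotheSubmodule 𝕜 p a) (k : ℕ) :
    ∃ l C, ∀ i, a i k * ‖w i‖ ≤ C * a (i + 1) l := by
  by_contra! hcon
  have hpos : ∀ i, 0 < a i k * ‖w i‖ := fun i => mul_pos (ha i k) (norm_pos_iff.2 (hw i))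
  -- Pairs (rank, i) with distinct i and weights a_{i,k}|w_i| large against a_{i+1,rank}. The vector
  -- with the reciprocals of these weights at i + 1 lies in the space, yet its image has infinitely
  -- many weighted entries equal to 1.
  obtain ⟨f, hfP, hfr⟩ := exists_seq_of_forall_finset_exists
    (fun x : ℕ × ℤ => a (x.2 + 1) x.1 ≤ (1 / 2) ^ x.1 * (a x.2 k * ‖w x.2‖))
    (fun x y => x.1 < y.1 ∧ x.2 ≠ y.2) (by
      intro s _
      set t := s.sup Prod.fst + 1 with ht
      have hterm : ∀ x : ℕ × ℤ, 0 ≤ a x.2 k * ‖w x.2‖ / a (x.2 + 1) t := fun x =>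
        div_nonneg (hpos _).le (ha _ _).le
      -- The power makes the new weight large; the sum exceeds the ratio at every earlier index, so
      -- none is repeated.
      obtain ⟨i, hi⟩ := hcon t (2 ^ t + ∑ x ∈ s, a x.2 k * ‖w x.2‖ / a (x.2 + 1) t)
      have hsum : 0 ≤ ∑ x ∈ s, a x.2 k * ‖w x.2‖ / a (x.2 + 1) t :=
        Finset.sum_nonneg fun x _ => hterm x
      refine ⟨(t, i), ?_, fun x hx => ⟨Nat.lt_succ_of_le (Finset.le_sup (f := Prod.fst) hx), ?_⟩⟩
      · have : 2 ^ t * a (i + 1) t ≤ a i k * ‖w i‖ := by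
          nlinarith [mul_nonneg hsum (ha (i + 1) t).le]
        rw [one_div, inv_pow, inv_mul_eq_div, le_div_iff₀ (by positivity), mul_comm]
        exact this
      · rintro rfl
        have h1 := Finset.single_le_sum (fun x _ => hterm x) hx
        rw [div_le_iff₀ (ha _ _)] at h1
        have h2 : 0 < 2 ^ t * a (x.2 + 1) t := mul_pos (by positivity) (ha _ _)
        linarith)
  have hmonof : StrictMono fun t => (f t).1 := fun s t h => (hfr s t h).1
  have hinj : Function.Injective fun t => (f t).2 :=
    Function.Injective.of_lt_imp_ne fun s t h => (hfr s t h).2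
  have hJ : Function.Injective fun t => (f t).2 + 1 := (add_left_injective 1).comp hinj
  have hc : ∀ t, 0 ≤ (a (f t).2 k * ‖w (f t).2‖)⁻¹ := fun t => inv_nonneg.2 (hpos _).le
  have hmem := hB _ (extend_mem_kotheSubmodule (𝕜 := 𝕜) (p := p) (fun j k => (ha j k).le) hmono
    hJ hc fun t => by
      rw [← div_eq_mul_inv, div_le_iff₀ (hpos _)]
      refine (hmono _ (hmonof.id_le t)).trans ((hfP t).trans ?_)
      exact mul_le_mul_of_nonneg_right
        (pow_le_pow_of_le_one (by norm_num) (by norm_num) (hmonof.id_le t)) (hpos _).le) k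
  have hone : ∀ t, ‖(a (f t).2 k : 𝕜) * bilateralShift w (Function.extend
      (fun t => (f t).2 + 1) (fun t => (((a (f t).2 k * ‖w (f t).2‖)⁻¹ : ℝ) : 𝕜)) 0)
        (f t).2‖ = 1 := fun t => by
    rw [norm_kothe_weight_mul (ha _ _).le]
    change a (f t).2 k * ‖w (f t).2 * Function.extend (fun t => (f t).2 + 1) _ 0 ((f t).2 + 1)‖ = 1
    rw [hJ.extend_apply, norm_mul, RCLike.norm_ofReal, abs_of_nonneg (hc t), ← mul_assoc,
      mul_inv_cancel₀ (hpos _).ne']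
  have hcof := hinj.tendsto_cofinite
  unfold KotheCond at hmem
  split_ifs at hmem with h0
  · have := (hmem.norm).comp hcof
    simp only [Function.comp_def, hone, norm_zero] at this
    exact one_ne_zero (tendsto_nhds_unique tendsto_const_nhds this)
  · have := hmem.tendsto_cofinite_zero.comp hcof
    simp only [Function.comp_def, hone, Real.one_rpow] at this
    exact one_ne_zero (tendsto_nhds_unique tendsto_const_nhds this)

/-- Since the weights increase with the seminorm index, one seminorm and one constant control
finitely many iterates; the gliding hump uses this for all times chosen so far. -/
theorem exists_orbitNorm_le_of_finset (ha : ∀ j k, 0 < a j k) (hmono : ∀ j, Monotone (a j))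
    (h : ∀ k n, ∃ l C, ∀ j, orbitNorm a w k n j ≤ C * a j l) (F : Finset (ℕ × ℕ)) :
    ∃ l C, 0 ≤ C ∧ ∀ x ∈ F, ∀ j, orbitNorm a w x.1 x.2 j ≤ C * a j l := by
  choose l C hlC using h
  refine ⟨F.sup fun x => l x.1 x.2, ∑ x ∈ F, |C x.1 x.2|,
    Finset.sum_nonneg fun _ _ => abs_nonneg _, fun x hx j => (hlC x.1 x.2 j).trans ?_⟩
  refine mul_le_mul ?_ (hmono j (Finset.le_sup (f := fun x => l x.1 x.2) hx)) (ha _ _).le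
    (Finset.sum_nonneg fun _ _ => abs_nonneg _)
  exact (le_abs_self _).trans
    (Finset.single_le_sum (f := fun x => |C x.1 x.2|) (fun _ _ => abs_nonneg _) hx)

/-- If every `e_j` has an orbit tending to zero but the iterates are not equicontinuous, then
there are normalised multiples of basis vectors with large `n t`-th iterates and uniformly small
`m s`-th iterates. -/
theorem exists_glidingHump (ha : ∀ j k, 0 < a j k) (hmono : ∀ j, Monotone (a j))
    (hw : ∀ n, w n ≠ 0) (hbd : ∀ k n, ∃ l C, ∀ j, orbitNorm a w k n j ≤ C * a j l)
    (hzero : ∀ k j, Tendsto (fun n => orbitNorm a w k n j) atTop (𝓝 0)) (k : ℕ)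
    (hub : ∀ (l : ℕ) (C : ℝ), ∃ n j, C * a j l < orbitNorm a w k n j) :
    ∃ (J : ℕ → ℤ) (n m : ℕ → ℕ), Function.Injective J ∧ StrictMono n ∧ StrictMono m ∧
      (∀ t, a (J t) t ≤ (1 / 2) ^ t * orbitNorm a w k (n t) (J t)) ∧
      ∀ s t, orbitNorm a w s (m s) (J t) ≤ (1 / 2) ^ (s + t) * orbitNorm a w k (n t) (J t) := by
  have hg := orbitNorm_pos (a := a) (w := w) ha hw
  have hmonog : ∀ n j, Monotone fun k => orbitNorm a w k n j := fun n j k l h =>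
    mul_le_mul_of_nonneg_right (hmono _ h) (weightProd_pos hw _ _).le
  have hbdd : ∀ j, ∃ D, ∀ n, orbitNorm a w k n j ≤ D := fun j => by
    obtain ⟨D, hD⟩ := (hzero k j).bddAbove_range
    exact ⟨D, fun n => hD ⟨n, rfl⟩⟩
  choose D hD using hbdd
  have hD0 : ∀ j, 0 ≤ D j := fun j => (hg k 0 j).le.trans (hD j 0)
  -- A tuple consists of a rank t, a basis index j, a time n of large norm and a time m of small
  -- norm. The relation controls the new vector at the old times m and the old vectors at the new
  -- time m.
  obtain ⟨f, hfP, hfr⟩ := exists_seq_of_forall_finset_exists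
    (fun x : ℕ × ℤ × ℕ × ℕ =>
      a x.2.1 x.1 ≤ (1 / 2) ^ x.1 * orbitNorm a w k x.2.2.1 x.2.1 ∧
      orbitNorm a w x.1 x.2.2.2 x.2.1 ≤ (1 / 2) ^ (x.1 + x.1) * orbitNorm a w k x.2.2.1 x.2.1)
    (fun x y => x.1 < y.1 ∧ x.2.1 ≠ y.2.1 ∧ x.2.2.1 < y.2.2.1 ∧ x.2.2.2 < y.2.2.2 ∧
      orbitNorm a w x.1 x.2.2.2 y.2.1 ≤ (1 / 2) ^ (x.1 + y.1) * orbitNorm a w k y.2.2.1 y.2.1 ∧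
      orbitNorm a w y.1 y.2.2.2 x.2.1 ≤ (1 / 2) ^ (y.1 + x.1) * orbitNorm a w k x.2.2.1 x.2.1) (by
      intro s _
      set t := s.sup Prod.fst + 1 with ht
      set N := s.sup fun x => x.2.2.1 with hN
      set M := s.sup fun x => x.2.2.2 with hM
      have hst : ∀ x ∈ s, x.1 < t := fun x hx =>
        Nat.lt_succ_of_le (Finset.le_sup (f := Prod.fst) hx)
      -- The three groups are the old times m, all times up to N in the norm k, and the plain weight
      -- a_{j,t}, which is time 0.
      obtain ⟨l, C, hC, hlC⟩ := exists_orbitNorm_le_of_finset ha hmono hbd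
        (s.image (fun x => (x.1, x.2.2.2)) ∪ (Finset.range (N + 1)).image (fun n => (k, n))
          ∪ {(t, 0)})
      simp only [Finset.mem_union, Finset.mem_image, Finset.mem_singleton, Finset.mem_range]
        at hlC
      have hterm : ∀ x : ℕ × ℤ × ℕ × ℕ, 0 ≤ D x.2.1 / a x.2.1 l := fun x =>
        div_nonneg (hD0 _) (ha _ _).le
      -- The term 4 ^ t * C makes everything bounded by C small relative to the hump, the extra C
      -- forces n > N, and the sum rules out the earlier indices, whose whole orbits are bounded by
      -- D.
      obtain ⟨n, j, hnj⟩ := hub l (4 ^ t * C + C + ∑ x ∈ s, D x.2.1 / a x.2.1 l)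
      have hsum : 0 ≤ (∑ x ∈ s, D x.2.1 / a x.2.1 l) * a j l :=
        mul_nonneg (Finset.sum_nonneg fun x _ => hterm x) (ha _ _).le
      have hCa : 0 ≤ C * a j l := mul_nonneg hC (ha _ _).le
      have h4C : 0 ≤ 4 ^ t * (C * a j l) := mul_nonneg (by positivity) hCa
      have hlarge : 4 ^ t * (C * a j l) ≤ orbitNorm a w k n j := by linarith
      have hsmall : C * a j l ≤ (1 / 4) ^ t * orbitNorm a w k n j := by
        rw [one_div, inv_pow, inv_mul_eq_div, le_div_iff₀ (by positivity), mul_comm]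
        exact hlarge
      have hquarter : ∀ q ≤ t, ((1 : ℝ) / 4) ^ t ≤ (1 / 2) ^ (t + q) := fun q hq => by
        rw [show ((1 : ℝ) / 4) = (1 / 2) ^ 2 by norm_num, ← pow_mul]
        exact pow_le_pow_of_le_one (by norm_num) (by norm_num) (by omega)
      have hevent : ∀ᶠ m in atTop, ∀ x ∈ insert (t, j, n, 0) s,
          orbitNorm a w t m x.2.1 < (1 / 4) ^ t * orbitNorm a w k x.2.2.1 x.2.1 :=
        (Filter.eventually_all_finset _).2 fun x _ =>
          (hzero t x.2.1).eventually (gt_mem_nhds (mul_pos (by positivity) (hg _ _ _)))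
      obtain ⟨m, hm, hMm⟩ := (hevent.and (eventually_gt_atTop M)).exists
      refine ⟨(t, j, n, m), ⟨?_, ?_⟩, fun x hx => ⟨hst x hx, ?_, ?_, ?_, ?_, ?_⟩⟩
      · have h1 := hlC (t, 0) (Or.inr rfl) j
        rw [orbitNorm_zero] at h1
        exact (h1.trans hsmall).trans
          (mul_le_mul_of_nonneg_right (hquarter 0 (Nat.zero_le _)) (hg _ _ _).le)
      · exact (hm _ (Finset.mem_insert_self _ _)).le.trans
          (mul_le_mul_of_nonneg_right (hquarter t le_rfl) (hg _ _ _).le)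
      · rintro rfl
        have h1 := Finset.single_le_sum (fun x _ => hterm x) hx
        rw [div_le_iff₀ (ha _ _)] at h1
        have h2 := hD x.2.1 n
        linarith
      · refine lt_of_le_of_lt (Finset.le_sup (f := fun x => x.2.2.1) hx) ?_
        by_contra! hle
        have h1 := hlC (k, n) (Or.inl (Or.inr ⟨n, Nat.lt_succ_of_le hle, rfl⟩)) j
        simp only at h1
        linarith
      · exact lt_of_le_of_lt (Finset.le_sup (f := fun x => x.2.2.2) hx) hMm
      · have h1 := hlC (x.1, x.2.2.2) (Or.inl (Or.inl ⟨x, hx, rfl⟩)) j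
        refine (h1.trans hsmall).trans ?_
        rw [add_comm x.1]
        exact mul_le_mul_of_nonneg_right (hquarter _ (hst x hx).le) (hg _ _ _).le
      · exact (hm _ (Finset.mem_insert_of_mem hx)).le.trans
          (mul_le_mul_of_nonneg_right (hquarter _ (hst x hx).le) (hg _ _ _).le))
  -- Ranks strictly increase, so the t-th rank is at least t and estimates in terms of ranks imply
  -- those in terms of positions.
  have hrank : StrictMono fun t => (f t).1 := fun s t h => (hfr s t h).1
  have hpow : ∀ q r : ℕ, q ≤ r → ((1 : ℝ) / 2) ^ r ≤ (1 / 2) ^ q := fun q r h =>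
    pow_le_pow_of_le_one (by norm_num) (by norm_num) h
  refine ⟨fun t => (f t).2.1, fun t => (f t).2.2.1, fun t => (f t).2.2.2,
    Function.Injective.of_lt_imp_ne fun s t h => (hfr s t h).2.1, fun s t h => (hfr s t h).2.2.1,
    fun s t h => (hfr s t h).2.2.2.1, fun t => ?_, fun s t => ?_⟩
  · exact (hmono _ (hrank.id_le t)).trans ((hfP t).1.trans
      (mul_le_mul_of_nonneg_right (hpow _ _ (hrank.id_le t)) (hg _ _ _).le))
  · refine (hmonog _ _ (hrank.id_le s)).trans (le_trans ?_ (mul_le_mul_of_nonneg_right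
      (hpow _ _ (add_le_add (hrank.id_le s) (hrank.id_le t))) (hg _ _ _).le))
    rcases lt_trichotomy s t with h | rfl | h
    · exact (hfr s t h).2.2.2.2.1
    · exact (hfP s).2
    · exact (hfr t s h).2.2.2.2.2

end GlidingHump

/-! ### Li-Yorke chaos and semi-irregular vectors -/

section Chaos

theorem liminf_eq_zero_iff_exists_strictMono {u : ℕ → ENNReal} :
    liminf u atTop = 0 ↔ ∃ φ : ℕ → ℕ, StrictMono φ ∧ Tendsto (u ∘ φ) atTop (𝓝 0) := by
  constructor
  · intro h
    have hf : ∀ n : ℕ, ∃ᶠ m in atTop, u m < (n + 1 : ENNReal)⁻¹ := fun n => by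
      refine frequently_lt_of_liminf_lt (by isBoundedDefault) ?_
      rw [h, ENNReal.inv_pos]
      exact_mod_cast ENNReal.natCast_ne_top (n + 1)
    obtain ⟨φ, hφ, hu⟩ := extraction_forall_of_frequently hf
    refine ⟨φ, hφ, tendsto_of_tendsto_of_tendsto_of_le_of_le tendsto_const_nhds
      ((tendsto_add_atTop_iff_nat 1).2 ENNReal.tendsto_inv_nat_nhds_zero) (fun _ => zero_le)
      fun n => ?_⟩
    have := (hu n).le
    simpa using this
  · rintro ⟨φ, hφ, hu⟩
    have h := hu.liminf_eq
    refine le_antisymm ?_ zero_le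
    rw [← h]
    exact liminf_le_liminf_of_le (g := map φ atTop) hφ.tendsto_atTop

theorem limsup_pos_iff_not_tendsto {u : ℕ → ENNReal} :
    0 < limsup u atTop ↔ ¬ Tendsto u atTop (𝓝 0) := by
  rw [pos_iff_ne_zero, not_iff_not]
  refine ⟨fun h => ?_, fun h => h.limsup_eq⟩
  exact tendsto_of_le_liminf_of_limsup_le zero_le h.le

variable {𝕜 : Type*} [RCLike 𝕜] {p : ℝ} [Fact (p = 0 ∨ 1 ≤ p)] {a : ℤ → ℕ → ℝ}

theorem IsKotheMetric.tendsto_edist_iff {d : MetricSpace (KotheSpace 𝕜 p a)}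
    (hd : IsKotheMetric 𝕜 p a d) {x y : ℕ → KotheSpace 𝕜 p a} :
    Tendsto (fun n => edist (x n) (y n)) atTop (𝓝 0) ↔
      ∀ k, Tendsto (fun n => kotheSeminorm 𝕜 p a k (x n - y n)) atTop (𝓝 0) := by
  have e : ∀ n, edist (x n) (y n) = edist (x n - y n) 0 := fun n => by
    rw [edist_dist, edist_dist, ← hd.dist_add_right (x n - y n) 0 (y n), sub_add_cancel, zero_add]
  simp only [e]
  rw [← tendsto_iff_edist_tendsto_0 (f := fun n => x n - y n), hd.withSeminorms.tendsto_nhds]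
  refine forall_congr' fun k => ?_
  rw [Metric.tendsto_nhds]
  refine forall₂_congr fun ε _ => eventually_congr (Eventually.of_forall fun n => ?_)
  rw [sub_zero, Real.dist_eq, sub_zero, abs_of_nonneg (apply_nonneg _ _)]

/-- A continuous linear map is Li-Yorke chaotic if and only if it has a semi-irregular vector. -/
theorem IsKotheMetric.liYorkeChaotic_iff {d : MetricSpace (KotheSpace 𝕜 p a)}
    (hd : IsKotheMetric 𝕜 p a d) (T : KotheSpace 𝕜 p a →ₗ[𝕜] KotheSpace 𝕜 p a)
    (hT : Continuous T) :
    LiYorkeChaotic T ↔ ∃ z : KotheSpace 𝕜 p a,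
      (∃ φ : ℕ → ℕ, StrictMono φ ∧
        ∀ k, Tendsto (fun i => kotheSeminorm 𝕜 p a k (T^[φ i] z)) atTop (𝓝 0)) ∧
      ∃ k, ¬ Tendsto (fun n => kotheSeminorm 𝕜 p a k (T^[n] z)) atTop (𝓝 0) := by
  have hsub : ∀ n x y, T^[n] x - T^[n] y = T^[n] (x - y) := fun n x y =>
    (iterate_map_sub T n x y).symm
  have hpair : ∀ x y : KotheSpace 𝕜 p a,
      (liminf (fun n : ℕ => edist (T^[n] x) (T^[n] y)) atTop = 0 ∧
        0 < limsup (fun n : ℕ => edist (T^[n] x) (T^[n] y)) atTop) ↔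
      (∃ φ : ℕ → ℕ, StrictMono φ ∧
        ∀ k, Tendsto (fun i => kotheSeminorm 𝕜 p a k (T^[φ i] (x - y))) atTop (𝓝 0)) ∧
      ∃ k, ¬ Tendsto (fun n => kotheSeminorm 𝕜 p a k (T^[n] (x - y))) atTop (𝓝 0) := by
    intro x y
    rw [liminf_eq_zero_iff_exists_strictMono, limsup_pos_iff_not_tendsto, hd.tendsto_edist_iff,
      not_forall]
    simp only [hsub]
    refine and_congr_left' (exists_congr fun φ => and_congr_right' ?_)
    refine (hd.tendsto_edist_iff (x := fun i => T^[φ i] x) (y := fun i => T^[φ i] y)).trans ?_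
    simp only [hsub]
  constructor
  · rintro ⟨-, S, hS, h⟩
    have hne : S.Nontrivial := by
      by_contra hS'
      exact hS (Set.not_nontrivial_iff.1 hS').countable
    obtain ⟨x, hx, y, hy, hxy⟩ := hne
    exact ⟨x - y, (hpair x y).1 (h x hx y hy hxy)⟩
  · rintro ⟨z, ⟨φ, hφ, hz⟩, k, hk⟩
    have hsmul : ∀ n k (c : 𝕜), kotheSeminorm 𝕜 p a k (T^[n] (c • z))
        = ‖c‖ * kotheSeminorm 𝕜 p a k (T^[n] z) := fun n k c => by
      rw [← map_smul_eq_mul]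
      congr 1
      rw [← Module.End.pow_apply, ← Module.End.pow_apply, map_smul]
    have hz0 : z ≠ 0 := by
      rintro rfl
      refine hk ?_
      have : ∀ n, T^[n] (0 : KotheSpace 𝕜 p a) = 0 := fun n => iterate_map_zero T n
      simp [this]
    -- The real multiples of z form the uncountable set: differences of distinct members are nonzero
    -- multiples of z, hence again semi-irregular.
    have hinj : Function.Injective fun c : ℝ => (c : 𝕜) • z :=
      (smul_left_injective 𝕜 hz0).comp RCLike.ofReal_injective
    refine ⟨hT, Set.range fun c : ℝ => (c : 𝕜) • z, fun hc => ?_, ?_⟩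
    · refine Cardinal.not_countable_real ?_
      have := hc.preimage_of_injOn hinj.injOn
      rwa [Set.preimage_range] at this
    · rintro _ ⟨b, rfl⟩ _ ⟨c, rfl⟩ hbc
      have hbc' : ((b : 𝕜) - c) ≠ 0 := fun h => hbc (by
        simp only [sub_eq_zero.1 h])
      rw [hpair, ← sub_smul]
      refine ⟨⟨φ, hφ, fun k => ?_⟩, k, fun h => hk ?_⟩
      · simp only [hsmul]
        simpa using (hz k).const_mul ‖(b : 𝕜) - c‖
      · simp only [hsmul] at h
        have h1 := h.const_mul ‖(b : 𝕜) - c‖⁻¹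
        simpa only [mul_zero, inv_mul_cancel_left₀ (norm_ne_zero_iff.2 hbc')] using h1

end Chaos

/-! ### Iterates of the shift -/

section Shift

variable {𝕜 : Type*} [RCLike 𝕜] {p : ℝ} [Fact (p = 0 ∨ 1 ≤ p)] {a : ℤ → ℕ → ℝ} {w : ℤ → 𝕜}

/-- `kotheShift` as a linear map. -/
def kotheShiftLinear (hB : ∀ x ∈ kotheSubmodule 𝕜 p a, bilateralShift w x ∈ kotheSubmodule 𝕜 p a) :
    KotheSpace 𝕜 p a →ₗ[𝕜] KotheSpace 𝕜 p a :=
  (bilateralShift w).restrict hB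

theorem coe_kotheShiftLinear
    (hB : ∀ x ∈ kotheSubmodule 𝕜 p a, bilateralShift w x ∈ kotheSubmodule 𝕜 p a) :
    ⇑(kotheShiftLinear hB) = kotheShift p a w hB := rfl

variable (hB : ∀ x ∈ kotheSubmodule 𝕜 p a, bilateralShift w x ∈ kotheSubmodule 𝕜 p a)

theorem norm_kotheShift_iterate_apply (n : ℕ) (x : KotheSpace 𝕜 p a) (i : ℤ) :
    ‖((kotheShift p a w hB)^[n] x).1 i‖ = weightProd w (i + n) n * ‖x.1 (i + n)‖ := by
  induction n generalizing i with
  | zero => simp [weightProd]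
  | succ n ih =>
    rw [Function.iterate_succ_apply']
    change ‖w i * ((kotheShift p a w hB)^[n] x).1 (i + 1)‖ = _
    have e : i + ((n + 1 : ℕ) : ℤ) = i + 1 + n := by push_cast; ring
    rw [norm_mul, ih, e, weightProd_succ, show i + 1 + (n : ℤ) - 1 - n = i by ring]
    ring

/-- Entry i of the n-th iterate comes from entry i + n. Sums and suprema over ℤ ignore this
translation, so iterating only changes the weights. -/
theorem weight_mul_norm_kotheShift_iterate (k n : ℕ) (x : KotheSpace 𝕜 p a) (i : ℤ) :
    a i k * ‖((kotheShift p a w hB)^[n] x).1 i‖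
      = orbitNorm a w k n (i + n) * ‖x.1 (i + n)‖ := by
  rw [norm_kotheShift_iterate_apply, orbitNorm, add_sub_cancel_right, mul_assoc]

theorem orbitNorm_mul_norm_le (h0 : ∀ j k, 0 ≤ a j k) (k n : ℕ) (x : KotheSpace 𝕜 p a) (j : ℤ) :
    orbitNorm a w k n j * ‖x.1 j‖ ≤ kotheSeminorm 𝕜 p a k ((kotheShift p a w hB)^[n] x) := by
  have h := weight_mul_norm_kotheShift_iterate hB k n x (j - n)
  rw [sub_add_cancel] at h
  rw [← h]
  exact (((kotheShift p a w hB)^[n] x).2 k).weight_mul_norm_le (fun j => h0 j k) _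

theorem kotheSeminorm_iterate_le_of_hasSum (h0 : ∀ j k, 0 ≤ a j k) {k n : ℕ}
    {x : KotheSpace 𝕜 p a} {S : ℝ} (hS : HasSum (fun j => orbitNorm a w k n j * ‖x.1 j‖) S) :
    kotheSeminorm 𝕜 p a k ((kotheShift p a w hB)^[n] x) ≤ S := by
  have h1 : HasSum (fun i => a i k * ‖((kotheShift p a w hB)^[n] x).1 i‖) S := by
    simp only [weight_mul_norm_kotheShift_iterate]
    exact ((Equiv.addRight (n : ℤ)).hasSum_iff
      (f := fun j => orbitNorm a w k n j * ‖x.1 j‖)).2 hS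
  rw [← h1.tsum_eq]
  exact (kotheCond_and_norm_le_tsum (fun j => h0 j k) h1.summable).2

theorem kotheSeminorm_iterate_le (h0 : ∀ j k, 0 ≤ a j k) {k l n : ℕ} {C : ℝ} (hC : 0 ≤ C)
    (h : ∀ j, orbitNorm a w k n j ≤ C * a j l) (x : KotheSpace 𝕜 p a) :
    kotheSeminorm 𝕜 p a k ((kotheShift p a w hB)^[n] x) ≤ C * kotheSeminorm 𝕜 p a l x := by
  refine kotheNorm_le_of_shift h0 (x.2 l) hC n fun i => ?_
  rw [weight_mul_norm_kotheShift_iterate, ← mul_assoc]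
  exact mul_le_mul_of_nonneg_right (h _) (norm_nonneg _)

theorem continuous_kotheShiftLinear {d : MetricSpace (KotheSpace 𝕜 p a)}
    (hd : IsKotheMetric 𝕜 p a d) (h0 : ∀ j k, 0 ≤ a j k)
    (h : ∀ k, ∃ l C, 0 ≤ C ∧ ∀ j, orbitNorm a w k 1 j ≤ C * a j l) :
    Continuous (kotheShiftLinear hB) := by
  refine WithSeminorms.continuous_of_isBounded hd.withSeminorms hd.withSeminorms _
    (Seminorm.IsBounded.of_real fun k => ?_)
  obtain ⟨l, C, hC, hl⟩ := h k
  refine ⟨{l}, C, fun x => ?_⟩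
  rw [Finset.sup_singleton]
  exact kotheSeminorm_iterate_le hB h0 hC hl x

end Shift

/-! ### The two implications -/

section Main

variable {𝕜 : Type*} [RCLike 𝕜] {p : ℝ} [Fact (p = 0 ∨ 1 ≤ p)] {a : ℤ → ℕ → ℝ} {w : ℤ → 𝕜}

theorem setOf_weight_ratio_eq (k l : ℕ) :
    {r : ℝ | ∃ i j : ℤ, i ≤ j ∧ r = a i k * ‖∏ m ∈ Finset.Icc i j, w m‖ / a (j + 1) l}
      = {r : ℝ | ∃ (n : ℕ) (j : ℤ), r = orbitNorm a w k (n + 1) j / a j l} := by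
  ext r
  constructor
  · rintro ⟨i, j, hij, rfl⟩
    refine ⟨(j - i).toNat, j + 1, ?_⟩
    have e : j + 1 - (((j - i).toNat + 1 : ℕ) : ℤ) = i := by omega
    have h := norm_prod_Icc_eq_weightProd (w := w) (j + 1) ((j - i).toNat + 1)
    rw [e, add_sub_cancel_right] at h
    rw [orbitNorm, e, h]
  · rintro ⟨n, j, rfl⟩
    refine ⟨j - ((n + 1 : ℕ) : ℤ), j - 1, by omega, ?_⟩
    rw [norm_prod_Icc_eq_weightProd, sub_add_cancel, orbitNorm]

theorem tendsto_weight_mul_prod_iff (h0 : ∀ j k, 0 ≤ a j k) (k : ℕ) (φ : ℕ → ℕ) :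
    Tendsto (fun i => (a (-(φ i : ℤ)) k : 𝕜) * ∏ m ∈ Finset.Icc (-(φ i : ℤ)) (-1), w m)
        atTop (𝓝 0) ↔
      Tendsto (fun i => orbitNorm a w k (φ i) 0) atTop (𝓝 0) := by
  rw [tendsto_zero_iff_norm_tendsto_zero]
  refine iff_of_eq (congrArg (Tendsto · atTop (𝓝 0)) (funext fun i => ?_))
  have h := norm_prod_Icc_eq_weightProd (w := w) 0 (φ i)
  rw [zero_sub, zero_sub] at h
  rw [norm_kothe_weight_mul (h0 _ _), h, orbitNorm, zero_sub]

variable (hB : ∀ x ∈ kotheSubmodule 𝕜 p a, bilateralShift w x ∈ kotheSubmodule 𝕜 p a)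

/-- A vector with a null subsequence of its orbit forces such a subsequence for `e_0`. -/
theorem exists_orbitNorm_zero_tendsto (h0 : ∀ j k, 0 ≤ a j k) (hw : ∀ n, w n ≠ 0)
    {z : KotheSpace 𝕜 p a} (hz0 : z ≠ 0) {φ : ℕ → ℕ} (hφ : StrictMono φ)
    (hz : ∀ k, Tendsto (fun i => kotheSeminorm 𝕜 p a k ((kotheShift p a w hB)^[φ i] z))
      atTop (𝓝 0)) :
    ∃ ψ : ℕ → ℕ, StrictMono ψ ∧ ∀ k, Tendsto (fun i => orbitNorm a w k (ψ i) 0) atTop (𝓝 0) := by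
  obtain ⟨m, hm⟩ : ∃ m, z.1 m ≠ 0 := by
    by_contra! h
    exact hz0 (Subtype.ext (funext h))
  refine (exists_orbitNorm_tendsto_iff hw m).1 ⟨φ, hφ, fun k => ?_⟩
  have hm' := norm_pos_iff.2 hm
  refine squeeze_zero (fun i => mul_nonneg (h0 _ _) (weightProd_pos hw _ _).le)
    (fun i => (le_div_iff₀ hm').2 (orbitNorm_mul_norm_le hB h0 k (φ i) z m)) ?_
  simpa using (hz k).div_const ‖z.1 m‖

/-- If the iterates are equicontinuous, an orbit with a null subsequence is null. -/
theorem tendsto_of_equicontinuous (h0 : ∀ j k, 0 ≤ a j k)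
    (h : ∀ k, ∃ l C, 0 ≤ C ∧ ∀ n j, orbitNorm a w k n j ≤ C * a j l)
    {z : KotheSpace 𝕜 p a} {φ : ℕ → ℕ}
    (hz : ∀ k, Tendsto (fun i => kotheSeminorm 𝕜 p a k ((kotheShift p a w hB)^[φ i] z))
      atTop (𝓝 0)) (k : ℕ) :
    Tendsto (fun n => kotheSeminorm 𝕜 p a k ((kotheShift p a w hB)^[n] z)) atTop (𝓝 0) := by
  obtain ⟨l, C, hC, hl⟩ := h k
  have h1 := (hz l).const_mul C
  rw [mul_zero] at h1
  rw [Metric.tendsto_atTop]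
  intro ε hε
  obtain ⟨i, hi⟩ := (h1.eventually (gt_mem_nhds hε)).exists
  refine ⟨φ i, fun n hn => ?_⟩
  rw [Real.dist_eq, sub_zero, abs_of_nonneg (apply_nonneg _ _)]
  refine lt_of_le_of_lt ?_ hi
  -- The n-th iterate is the (n - φ i)-th iterate applied to the small vector at time φ i, and the
  -- equicontinuity bound is uniform in n - φ i.
  rw [← Nat.sub_add_cancel hn, Function.iterate_add_apply]
  exact kotheSeminorm_iterate_le hB h0 hC (hl _) _

/-- The basis vector `e_j` lies in the Köthe space. -/
theorem single_mem_kotheSubmodule (h0 : ∀ j k, 0 ≤ a j k) (j : ℤ) :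
    (Pi.single j 1 : ℤ → 𝕜) ∈ kotheSubmodule 𝕜 p a := fun k =>
  (kotheCond_and_norm_le_tsum (fun j => h0 j k) (summable_of_ne_finset_zero (s := {j})
    fun i hi => by
      rw [Pi.single_eq_of_ne (Finset.notMem_singleton.1 hi), norm_zero, mul_zero])).1

theorem kotheSeminorm_iterate_single (h0 : ∀ j k, 0 ≤ a j k) (k n : ℕ) (j : ℤ) :
    kotheSeminorm 𝕜 p a k ((kotheShift p a w hB)^[n] ⟨_, single_mem_kotheSubmodule h0 j⟩)
      = orbitNorm a w k n j := by
  refine le_antisymm (kotheSeminorm_iterate_le_of_hasSum hB h0 ?_) ?_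
  · have h := hasSum_single (f := fun i => orbitNorm a w k n i * ‖(Pi.single j 1 : ℤ → 𝕜) i‖) j
      fun i hi => by rw [Pi.single_eq_of_ne hi, norm_zero, mul_zero]
    simpa only [Pi.single_eq_same, norm_one, mul_one] using h
  · have h := orbitNorm_mul_norm_le hB h0 k n ⟨_, single_mem_kotheSubmodule h0 j⟩ j
    simpa only [Pi.single_eq_same, norm_one, mul_one] using h

/-- A basis vector with a non-null orbit already works; if there is none, the gliding hump applies.
-/
theorem exists_semiIrregular (ha : ∀ j k, 0 < a j k) (hmono : ∀ j, Monotone (a j))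
    (hw : ∀ n, w n ≠ 0)
    (hzero : ∃ φ : ℕ → ℕ, StrictMono φ ∧
      ∀ k, Tendsto (fun i => orbitNorm a w k (φ i) 0) atTop (𝓝 0)) {k : ℕ}
    (hub : ∀ (l : ℕ) (C : ℝ), ∃ n j, C * a j l < orbitNorm a w k n j) :
    ∃ z : KotheSpace 𝕜 p a,
      (∃ φ : ℕ → ℕ, StrictMono φ ∧ ∀ k, Tendsto
        (fun i => kotheSeminorm 𝕜 p a k ((kotheShift p a w hB)^[φ i] z)) atTop (𝓝 0)) ∧
      ∃ k, ¬ Tendsto (fun n => kotheSeminorm 𝕜 p a k ((kotheShift p a w hB)^[n] z))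
        atTop (𝓝 0) := by
  have h0 : ∀ j k, 0 ≤ a j k := fun j k => (ha j k).le
  by_cases hcase : ∀ k j, Tendsto (fun n => orbitNorm a w k n j) atTop (𝓝 0)
  swap
  · push Not at hcase
    obtain ⟨k', j, hj⟩ := hcase
    refine ⟨⟨_, single_mem_kotheSubmodule h0 j⟩, ?_, k', ?_⟩
    · simp only [kotheSeminorm_iterate_single hB h0]
      exact (exists_orbitNorm_tendsto_iff hw j).2 hzero
    · simpa only [kotheSeminorm_iterate_single hB h0] using hj
  obtain ⟨J, n, m, hJ, hn, hm, hle, hsmall⟩ := exists_glidingHump ha hmono hw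
    (exists_orbitNorm_le ha (exists_weight_mul_norm_le ha hmono hw hB)) hcase k hub
  have hg := orbitNorm_pos (a := a) (w := w) ha hw
  -- These reciprocals are the coefficients of z; they give the coordinate J t weight exactly 1 at
  -- time n t.
  have hc : ∀ t, 0 ≤ (orbitNorm a w k (n t) (J t))⁻¹ := fun t => (inv_pos.2 (hg _ _ _)).le
  have hmem := extend_mem_kotheSubmodule (𝕜 := 𝕜) (p := p) h0 hmono hJ hc fun t => by
    rw [← div_eq_mul_inv, div_le_iff₀ (hg _ _ _)]
    exact hle t
  refine ⟨⟨_, hmem⟩, ⟨m, hm, fun l => ?_⟩, k, fun hlim => ?_⟩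
  · have hbound : ∀ s, l ≤ s → kotheSeminorm 𝕜 p a l
        ((kotheShift p a w hB)^[m s] ⟨_, hmem⟩) ≤ (1 / 2) ^ s * 2 := by
      intro s hs
      have hterm : ∀ t, orbitNorm a w l (m s) (J t) * (orbitNorm a w k (n t) (J t))⁻¹
          ≤ (1 / 2) ^ s * (1 / 2) ^ t := fun t => by
        rw [← div_eq_mul_inv, div_le_iff₀ (hg _ _ _), ← pow_add]
        exact (mul_le_mul_of_nonneg_right (hmono _ hs) (weightProd_pos hw _ _).le).trans
          (hsmall s t)
      have hgeom := hasSum_geometric_two.mul_left ((1 / 2 : ℝ) ^ s)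
      have hsum : Summable fun t => orbitNorm a w l (m s) (J t)
          * (orbitNorm a w k (n t) (J t))⁻¹ :=
        hgeom.summable.of_nonneg_of_le (fun t => mul_nonneg (hg _ _ _).le (hc t)) hterm
      have hz := (hasSum_mul_norm_extend_iff (𝕜 := 𝕜) hJ hc (orbitNorm a w l (m s)) _).2 hsum.hasSum
      exact (kotheSeminorm_iterate_le_of_hasSum hB h0 (x := ⟨_, hmem⟩) hz).trans
        (hasSum_le hterm hsum.hasSum hgeom)
    have hlim : Tendsto (fun s : ℕ => (1 / 2 : ℝ) ^ s * 2) atTop (𝓝 0) := by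
      simpa using (tendsto_pow_atTop_nhds_zero_of_lt_one (r := (1 / 2 : ℝ)) (by norm_num)
        (by norm_num)).mul_const 2
    exact squeeze_zero' (Eventually.of_forall fun s => kotheNorm_nonneg l _)
      ((eventually_ge_atTop l).mono hbound) hlim
  · have hone : ∀ t, 1 ≤ kotheSeminorm 𝕜 p a k ((kotheShift p a w hB)^[n t] ⟨_, hmem⟩) := by
      intro t
      have h := orbitNorm_mul_norm_le hB h0 k (n t) ⟨_, hmem⟩ (J t)
      simp only [hJ.extend_apply, RCLike.norm_ofReal, abs_of_nonneg (hc t)] at h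
      rwa [mul_inv_cancel₀ (hg _ _ _).ne'] at h
    exact absurd (ge_of_tendsto' (hlim.comp hn.tendsto_atTop) hone) (by norm_num)

end Main

theorem theorem4p11 {𝕜 : Type*} [RCLike 𝕜] (p : ℝ) [Fact (p = 0 ∨ 1 ≤ p)]
    (a : ℤ → ℕ → ℝ) (hA : IsKotheMatrix a) (ha : ∀ j k, a j k ≠ 0)
    (d : MetricSpace (KotheSpace 𝕜 p a)) (hd : IsKotheMetric 𝕜 p a d)
    (w : ℤ → 𝕜) (hw : ∀ n, w n ≠ 0)
    (hB : ∀ x ∈ kotheSubmodule 𝕜 p a, bilateralShift w x ∈ kotheSubmodule 𝕜 p a) :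
    LiYorkeChaotic (kotheShift p a w hB) ↔
      (∃ n : ℕ → ℕ, StrictMono n ∧ (∀ i, 0 < n i) ∧ ∀ k : ℕ,
        Tendsto (fun i => (a (-(n i : ℤ)) k : 𝕜) * ∏ m ∈ Finset.Icc (-(n i : ℤ)) (-1), w m)
          atTop (𝓝 0)) ∧
      (∃ k : ℕ, ∀ l : ℕ,
        ¬ BddAbove {r : ℝ | ∃ i j : ℤ, i ≤ j ∧
          r = a i k * ‖∏ m ∈ Finset.Icc i j, w m‖ / a (j + 1) l}) := by
  have h0 := hA.nonneg
  have hpos : ∀ j k, 0 < a j k := fun j k => (h0 j k).lt_of_ne' (ha j k)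
  have hmono : ∀ j, Monotone (a j) := fun j => monotone_nat_of_le_succ (hA.le_succ j)
  have hbd := exists_orbitNorm_le hpos (exists_weight_mul_norm_le hpos hmono hw hB)
  have hcont : Continuous (kotheShiftLinear hB) :=
    continuous_kotheShiftLinear hB hd h0 fun k => by
      obtain ⟨l, C, h⟩ := hbd k 1
      exact ⟨l, |C|, abs_nonneg C, fun j => (h j).trans
        (mul_le_mul_of_nonneg_right (le_abs_self C) (h0 j l))⟩
  have hchaos := hd.liYorkeChaotic_iff (kotheShiftLinear hB) hcont
  rw [coe_kotheShiftLinear] at hchaos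
  rw [hchaos]
  simp only [setOf_weight_ratio_eq, tendsto_weight_mul_prod_iff h0]
  constructor
  · rintro ⟨z, ⟨φ, hφ, hz⟩, k, hk⟩
    constructor
    · have hz0 : z ≠ 0 := by
        rintro rfl
        have h : ∀ n, (kotheShift p a w hB)^[n] 0 = 0 := fun n =>
          iterate_map_zero (kotheShiftLinear hB) n
        simp [h] at hk
      obtain ⟨ψ, hψ, h⟩ := exists_orbitNorm_zero_tendsto hB h0 hw hz0 hφ hz
      exact ⟨fun i => ψ (i + 1), fun i j hij => hψ (Nat.succ_lt_succ hij),
        fun i => (Nat.zero_le _).trans_lt (hψ (Nat.lt_succ_self i)),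
        fun k => (h k).comp (tendsto_add_atTop_nat 1)⟩
    · by_contra! hcon
      refine hk (tendsto_of_equicontinuous hB h0 (fun k => ?_) hz k)
      obtain ⟨l, C, hC⟩ := hcon k
      -- Only iterates with n ≥ 1 occur in (b); the maxima also cover the identity, n = 0.
      refine ⟨max k l, max 1 C, zero_le_one.trans (le_max_left _ _), fun n j => ?_⟩
      rcases n with _ | n
      · rw [orbitNorm_zero, ← one_mul (a j k)]
        exact mul_le_mul (le_max_left _ _) (hmono j (le_max_left _ _)) (h0 _ _)
          (zero_le_one.trans (le_max_left _ _))
      · have h := (div_le_iff₀ (hpos j l)).1 (hC ⟨n, j, rfl⟩)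
        exact h.trans (mul_le_mul (le_max_right _ _) (hmono j (le_max_right _ _)) (h0 _ _)
          (zero_le_one.trans (le_max_left _ _)))
  · rintro ⟨⟨φ, hφ, -, hz⟩, k, hk⟩
    refine exists_semiIrregular hB hpos hmono hw ⟨φ, hφ, hz⟩ (k := k) fun l C => ?_
    obtain ⟨_, ⟨n, j, rfl⟩, h⟩ := not_bddAbove_iff.1 (hk l) C
    exact ⟨n + 1, j, (lt_div_iff₀ (hpos j l)).1 h⟩
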